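/- Let $X=(X,d_X,\mu_X)$ be a metric measure space with boundary, i.e. a connected complete Riemannian manifold with boundary $\partial X$, its Riemannian distance $d_X$ and a Borel probability measure $\mu_X$. For $\Omega\subset X$ put $\operatorname{InRad}\Omega:=\sup_{x\in\Omega}d_X(x,\partial X)$ (and $0$ if $\Omega=\emptyset$); for $\xi\le 1$ put $$\operatorname{PartInRad}(X;\xi):=\inf\{\operatorname{InRad}\Omega \mid \Omega\subset X \text{ Borel},\ \mu_X(\Omega)\ge\xi\};$$ and for $\eta>0$ put $$\operatorname{ObsInRad}(X;-\eta):=\sup_{\varphi}\operatorname{PartInRad}\bigl(([0,\infty),|\cdot|,\varphi_{\#}\mu_X);1-\eta\bigr),$$ where $\varphi$ runs over the $1$-Lipschitz functions $\varphi:X\to[0,\infty)$ with $\varphi|_{\partial X}=0$ and $[0,\infty)$ has boundary $\{0\}$. A sequence $\{X_n\}$ of such spaces is a boundary concentration family if $\lim_{n\to\infty}\operatorname{ObsInRad}(X_n;-\eta)=0$ for every $\eta>0$. For $\kappa>0$ and $n\ge 1$ let $B^n_{\kappa,0}$ be the closed hemisphere of the $n$-dimensional sphere of constant curvature $\kappa$,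 with its Riemannian distance and its normalized Riemannian volume measure, and let $G_{\kappa,0}$ be $[0,\infty)$ with the usual distance, boundary $\{0\}$ and the probability measure with density $e^{-\kappa t^2/2}/\int_0^\infty e^{-\kappa s^2/2}\,ds$. **Theorem.** For every $\kappa>0$ and every $\eta\in(0,1]$, $$\lim_{n\to\infty}\operatorname{ObsInRad}(B^n_{\kappa/n,0};-\eta)=\operatorname{PartInRad}(G_{\kappa,0};1-\eta),$$ and the right-hand side is the number $r\ge 0$ with $\int_0^r e^{-\kappa t^2/2}\,dt\big/\int_0^\infty e^{-\kappa t^2/2}\,dt=1-\eta$. Moreover, for a sequence $\{\kappa_n\}_{n\ge1}$ of positive numbers, $\{B^n_{\kappa_n,0}\}$ is a boundary concentration family if and only if $n\kappa_n\to\infty$. -/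

import Mathlib

open Set Filter Topology MeasureTheory Metric
open scoped NNReal ENNReal

noncomputable section

/-- The data of a metric measure space with boundary: the underlying set, its (Riemannian)
distance, a Borel probability measure and the boundary. These are all the data that the
invariants below depend on. -/
structure MMSpaceWithBoundary where
  carrier : Type
  [metric : MetricSpace carrier]
  [meas : MeasurableSpace carrier]
  [borel : BorelSpace carrier]
  μ : Measure carrier
  [prob : IsProbabilityMeasure μ]
  boundary : Set carrier

attribute [instance] MMSpaceWithBoundary.metric MMSpaceWithBoundary.meas
  MMSpaceWithBoundary.borel MMSpaceWithBoundary.prob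

namespace MMSpaceWithBoundary

/-- The distance from the boundary. -/
def rho (X : MMSpaceWithBoundary) (x : X.carrier) : ℝ≥0∞ := infEDist x X.boundary

/-- The inscribed radius of a subset: the supremum over it of the distance from the boundary
(it is `0` for the empty set). -/
def inRad (X : MMSpaceWithBoundary) (Ω : Set X.carrier) : ℝ≥0∞ := ⨆ x ∈ Ω, X.rho x

/-- The `ξ`-partial inscribed radius: the infimum of the inscribed radii of the Borel sets of
measure at least `ξ`. -/
def partInRad (X : MMSpaceWithBoundary) (ξ : ℝ) : ℝ≥0∞ :=
  ⨅ (Ω : Set X.carrier) (_ : MeasurableSet Ω) (_ : ξ ≤ X.μ.real Ω), X.inRad Ω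

/-- The `φ`-screen: `[0, ∞)` with its usual distance, the push-forward of the measure by `φ`,
and boundary `{0}`. -/
def screen (X : MMSpaceWithBoundary) (φ : X.carrier → ℝ≥0) (hφ : LipschitzWith 1 φ) :
    MMSpaceWithBoundary where
  carrier := ℝ≥0
  μ := X.μ.map φ
  prob := Measure.isProbabilityMeasure_map hφ.continuous.measurable.aemeasurable
  boundary := {0}

/-- The `η`-observable inscribed radius `ObsInRad(X; -η)`: the supremum of
`PartInRad(I_φ; 1 - η)` over the `1`-Lipschitz functions `φ : X → [0, ∞)` that vanish on the
boundary. -/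
def obsInRad (X : MMSpaceWithBoundary) (η : ℝ) : ℝ≥0∞ :=
  ⨆ (φ : X.carrier → ℝ≥0) (hφ : LipschitzWith 1 φ) (_ : ∀ x ∈ X.boundary, φ x = 0),
    (X.screen φ hφ).partInRad (1 - η)

end MMSpaceWithBoundary

/-- Boundary concentration families (sequences indexed by the integers `n ≥ 1`). -/
def IsBoundaryConcentrationFamily (X : ℕ+ → MMSpaceWithBoundary) : Prop :=
  ∀ η : ℝ, 0 < η → Tendsto (fun n => (X n).obsInRad η) atTop (𝓝 0)

/-! ### Hemispheres -/

/-- The closed unit hemisphere `{x ∈ S^n : x_n ≥ 0}` in `ℝ^{n+1}`. -/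
def UnitHemisphere (n : ℕ) : Type :=
  {x : sphere (0 : EuclideanSpace ℝ (Fin (n + 1))) 1 // 0 ≤ x.1 (Fin.last n)}

namespace UnitHemisphere

variable {n : ℕ}

instance : TopologicalSpace (UnitHemisphere n) :=
  inferInstanceAs (TopologicalSpace
    {x : sphere (0 : EuclideanSpace ℝ (Fin (n + 1))) 1 // 0 ≤ x.1 (Fin.last n)})

instance : MeasurableSpace (UnitHemisphere n) :=
  inferInstanceAs (MeasurableSpace
    {x : sphere (0 : EuclideanSpace ℝ (Fin (n + 1))) 1 // 0 ≤ x.1 (Fin.last n)})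

instance : BorelSpace (UnitHemisphere n) :=
  inferInstanceAs (BorelSpace
    {x : sphere (0 : EuclideanSpace ℝ (Fin (n + 1))) 1 // 0 ≤ x.1 (Fin.last n)})

/-- The point of the ambient Euclidean space. -/
def toVec (x : UnitHemisphere n) : EuclideanSpace ℝ (Fin (n + 1)) := x.1.1

lemma norm_toVec (x : UnitHemisphere n) : ‖x.toVec‖ = 1 := by
  simp [toVec]

lemma toVec_ne_zero (x : UnitHemisphere n) : x.toVec ≠ 0 := by
  intro h
  have := x.norm_toVec
  simp [h] at this

lemma isInducing_toVec : Topology.IsInducing (toVec (n := n)) :=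
  Topology.IsInducing.subtypeVal.comp Topology.IsInducing.subtypeVal

lemma toVec_injective : Function.Injective (toVec (n := n)) :=
  Subtype.val_injective.comp Subtype.val_injective

/-- The great-circle distance on the unit sphere: the angle between the two points. -/
def arc (x y : UnitHemisphere n) : ℝ := InnerProductGeometry.angle x.toVec y.toVec

lemma norm_sub_le_arc (x y : UnitHemisphere n) : ‖x.toVec - y.toVec‖ ≤ arc x y := by
  have h1 := InnerProductGeometry.cos_angle x.toVec y.toVec
  rw [norm_toVec, norm_toVec, mul_one, div_one] at h1
  have h2 := norm_sub_sq_real x.toVec y.toVec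
  rw [norm_toVec, norm_toVec, ← h1] at h2
  have h3 := Real.one_sub_sq_div_two_le_cos (x := arc x y)
  have h4 : 0 ≤ arc x y := InnerProductGeometry.angle_nonneg _ _
  unfold arc at *
  refine abs_le_of_sq_le_sq' ?_ h4 |>.2
  nlinarith

lemma continuous_arc (x : UnitHemisphere n) : Continuous (arc x) := by
  rw [continuous_iff_continuousAt]
  intro y
  have h := InnerProductGeometry.continuousAt_angle (x := (x.toVec, y.toVec))
    x.toVec_ne_zero y.toVec_ne_zero
  have h2 : ContinuousAt (fun z : UnitHemisphere n => (x.toVec, z.toVec)) y :=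
    (continuous_const.prodMk isInducing_toVec.continuous).continuousAt
  exact ContinuousAt.comp (f := fun z : UnitHemisphere n => (x.toVec, z.toVec)) h h2

lemma arc_self (x : UnitHemisphere n) : arc x x = 0 :=
  InnerProductGeometry.angle_self x.toVec_ne_zero

lemma isOpen_iff_arc (c : ℝ) (hc : 0 < c) (s : Set (UnitHemisphere n)) :
    IsOpen s ↔ ∀ x ∈ s, ∃ ε > 0, ∀ y, c * arc x y < ε → y ∈ s := by
  constructor
  · intro hs x hx
    obtain ⟨U, hU, rfl⟩ := isInducing_toVec.isOpen_iff.1 hs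
    obtain ⟨ε, hε, h⟩ := Metric.isOpen_iff.1 hU x.toVec hx
    refine ⟨c * ε, by positivity, fun y hy => h ?_⟩
    rw [mem_ball, dist_comm, dist_eq_norm]
    exact (norm_sub_le_arc x y).trans_lt (lt_of_mul_lt_mul_left hy hc.le)
  · intro h
    rw [isOpen_iff_mem_nhds]
    intro x hx
    obtain ⟨ε, hε, h⟩ := h x hx
    have h1 : Continuous fun y => c * arc x y := continuous_const.mul (continuous_arc x)
    have h2 : (fun y => c * arc x y) ⁻¹' Iio ε ∈ 𝓝 x :=
      (isOpen_Iio.preimage h1).mem_nhds (by simpa [arc_self] using hε)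
    exact mem_of_superset h2 fun y hy => h y hy

/-- The distance of the closed hemisphere of constant curvature `κ > 0` (that is, of radius
`1 / √κ`): `1 / √κ` times the great-circle distance of the unit sphere. As closed hemispheres are
geodesically convex, this is also the intrinsic Riemannian distance of the hemisphere. -/
@[reducible] def metricSpace (κ : ℝ) (hκ : 0 < κ) : MetricSpace (UnitHemisphere n) :=
  MetricSpace.ofDistTopology (fun x y => (√κ)⁻¹ * arc x y)
    (fun x => by simp [arc_self])
    (fun x y => by simp only [arc, InnerProductGeometry.angle_comm])
    (fun x y z => by
      rw [← mul_add]
      exact mul_le_mul_of_nonneg_left (InnerProductGeometry.angle_le_angle_add_angle _ _ _)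
        (by positivity))
    (isOpen_iff_arc _ (by positivity))
    (fun x y h => by
      have h0 : (√κ)⁻¹ ≠ 0 := (inv_pos.2 (Real.sqrt_pos.2 hκ)).ne'
      have h1 : arc x y = 0 := (mul_eq_zero.1 h).resolve_left h0
      have h2 := norm_sub_le_arc x y
      rw [h1] at h2
      exact toVec_injective (sub_eq_zero.1 (norm_le_zero_iff.1 h2)))

/-- The `n`-dimensional Riemannian (surface) measure of the unit sphere `S^n`, restricted to the
closed hemisphere. -/
def surfaceMeasure (n : ℕ) : Measure (UnitHemisphere n) :=
  ((volume : Measure (EuclideanSpace ℝ (Fin (n + 1)))).toSphere).comap Subtype.val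

lemma measurableSet_range_val (n : ℕ) : MeasurableSet
    {x : sphere (0 : EuclideanSpace ℝ (Fin (n + 1))) 1 | 0 ≤ x.1 (Fin.last n)} := by
  apply IsClosed.measurableSet
  exact isClosed_le continuous_const (by fun_prop)

lemma surfaceMeasure_univ (n : ℕ) : surfaceMeasure n univ =
    (volume : Measure (EuclideanSpace ℝ (Fin (n + 1)))).toSphere {x | 0 ≤ x.1 (Fin.last n)} := by
  have h := (MeasurableEmbedding.subtype_coe (measurableSet_range_val n)).comap_apply
    (volume : Measure (EuclideanSpace ℝ (Fin (n + 1)))).toSphere univ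
  refine h.trans ?_
  rw [image_univ, Subtype.range_coe_subtype]
  rfl

instance : IsFiniteMeasure (surfaceMeasure n) :=
  ⟨by rw [surfaceMeasure_univ]; exact measure_lt_top _ _⟩

instance : NeZero (surfaceMeasure n) := by
  refine ⟨fun h => ?_⟩
  have h1 := surfaceMeasure_univ n
  rw [h] at h1
  have h2 : IsOpen {x : sphere (0 : EuclideanSpace ℝ (Fin (n + 1))) 1 | 0 < x.1 (Fin.last n)} :=
    isOpen_lt continuous_const (by fun_prop)
  have h3 : {x : sphere (0 : EuclideanSpace ℝ (Fin (n + 1))) 1 |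
      0 < x.1 (Fin.last n)}.Nonempty :=
    ⟨⟨EuclideanSpace.single (Fin.last n) 1, by simp⟩, by simp⟩
  have h4 := h2.measure_pos
    (volume : Measure (EuclideanSpace ℝ (Fin (n + 1)))).toSphere h3
  have h6 : {x : sphere (0 : EuclideanSpace ℝ (Fin (n + 1))) 1 | 0 < x.1 (Fin.last n)} ⊆
      {x | 0 ≤ x.1 (Fin.last n)} := fun x (hx : 0 < x.1 (Fin.last n)) => hx.le
  have h5 := h4.trans_le (measure_mono h6)
  rw [← h1] at h5
  simp at h5

end UnitHemisphere

/-- The hemisphere `B^n_{κ,0}`, for `κ > 0`: the closed ball with totally geodesic boundary in the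
`n`-dimensional sphere of constant curvature `κ`, with its Riemannian distance, its normalized
Riemannian volume measure (normalizing makes the scale of the sphere irrelevant) and its
boundary, the equator. -/
def hemisphere (n : ℕ+) (κ : ℝ) (hκ : 0 < κ) : MMSpaceWithBoundary where
  carrier := UnitHemisphere n
  metric := UnitHemisphere.metricSpace κ hκ
  borel := inferInstanceAs (BorelSpace (UnitHemisphere n))
  μ := (UnitHemisphere.surfaceMeasure n univ)⁻¹ • UnitHemisphere.surfaceMeasure n
  prob := isProbabilityMeasureSMul
  boundary := {x | x.toVec (Fin.last n) = 0}

/-! ### The half-Gaussian model space -/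

/-- The density `e^{-K t²/2 - Λ t} / ∫_0^∞ e^{-K s²/2 - Λ s} ds`. -/
def halfGaussianDensity (K Λ t : ℝ) : ℝ :=
  Real.exp (-(K / 2) * t ^ 2 - Λ * t) /
    ∫ s in Ici (0 : ℝ), Real.exp (-(K / 2) * s ^ 2 - Λ * s)

/-- The probability measure on `[0, ∞)` with this density. -/
def halfGaussianMeasure (K Λ : ℝ) : Measure ℝ≥0 :=
  ((volume : Measure ℝ).comap ((↑) : ℝ≥0 → ℝ)).withDensity
    fun t => ENNReal.ofReal (halfGaussianDensity K Λ t)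

lemma integrable_halfGaussian (K Λ : ℝ) (hK : 0 < K) :
    Integrable fun s : ℝ => Real.exp (-(K / 2) * s ^ 2 - Λ * s) := by
  have h := (integrable_cexp_quadratic' (b := ((-(K / 2) : ℝ) : ℂ))
    (by rw [Complex.ofReal_re]; linarith) (((-Λ : ℝ)) : ℂ) 0).re
  refine h.congr (Eventually.of_forall fun s => ?_)
  have : (((-(K / 2) : ℝ) : ℂ) * (s : ℂ) ^ 2 + ((-Λ : ℝ) : ℂ) * (s : ℂ) + 0) =
      ((-(K / 2) * s ^ 2 - Λ * s : ℝ) : ℂ) := by push_cast; ring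
  simp only [this]
  exact Complex.exp_ofReal_re _

lemma isProbabilityMeasure_halfGaussian (K Λ : ℝ) (hK : 0 < K) :
    IsProbabilityMeasure (halfGaussianMeasure K Λ) := by
  have hint := (integrable_halfGaussian K Λ hK).integrableOn (s := Ici 0)
  have hpos : 0 < ∫ s in Ici (0 : ℝ), Real.exp (-(K / 2) * s ^ 2 - Λ * s) := by
    have : NeZero (volume.restrict (Ici (0 : ℝ))) := ⟨by simp [Measure.restrict_eq_zero]⟩
    have := integral_exp_pos (μ := volume.restrict (Ici (0 : ℝ))) hint
    exact this
  have hm : Measurable fun t : ℝ => ENNReal.ofReal (halfGaussianDensity K Λ t) := by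
    unfold halfGaussianDensity; fun_prop
  constructor
  rw [halfGaussianMeasure, withDensity_apply _ MeasurableSet.univ, Measure.restrict_univ]
  have he : MeasurableEmbedding ((↑) : ℝ≥0 → ℝ) :=
    MeasurableEmbedding.subtype_coe measurableSet_Ici
  have hr : range ((↑) : ℝ≥0 → ℝ) = Ici 0 := Subtype.range_coe
  rw [← he.lintegral_map (fun t => ENNReal.ofReal (halfGaussianDensity K Λ t)), he.map_comap, hr,
    ← ofReal_integral_eq_lintegral_ofReal]
  · simp only [halfGaussianDensity]
    rw [integral_div, div_self hpos.ne', ENNReal.ofReal_one]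
  · exact hint.div_const _
  · exact Eventually.of_forall fun t => div_nonneg (Real.exp_pos _).le hpos.le

/-- The half-Gaussian model space `G_{K,Λ}`, for `K > 0` and `Λ ∈ ℝ`. -/
def halfGaussian (K Λ : ℝ) (hK : 0 < K) : MMSpaceWithBoundary where
  carrier := ℝ≥0
  μ := halfGaussianMeasure K Λ
  prob := isProbabilityMeasure_halfGaussian K Λ hK
  boundary := {0}

end

/-!
On a space with nonempty boundary the distance `ρ` from the boundary is itself an admissible screen
function, and it dominates all the others. Hence the observable inscribed radius is the partial
inscribed radius of the space (`MMSpaceWithBoundary.obsInRad_eq_partInRad`), and this is a quantile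
of the law of `ρ`. Quantiles converge when the distribution functions converge to a strictly
increasing function (`MMSpaceWithBoundary.tendsto_partInRad`), so everything reduces to the law of
`ρ` on hemispheres.

On the hemisphere of curvature `κ`, `ρ` is `1 / √κ` times the latitude, the arcsine of the last
coordinate (`rho_hemisphere`). As the direction of a standard Gaussian vector is uniformly
distributed on the sphere (`ProbabilityTheory.exists_stdGaussian_cone_eq`), the latitude has the law
of `arcsin (g₀ / |g|)`, where `g` is a Gaussian vector conditioned on `0 ≤ g₀`
(`hemisphere_real_setOf_rho_le`). The vectors `g` of all dimensions can be taken from one sequence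
of independent Gaussian variables, and then the strong law of large numbers gives `|g| / √n → 1`
almost surely. So `√n` times the latitude converges almost surely to `g₀`, and by dominated
convergence its distribution functions converge to that of the half-Gaussian law
(`tendsto_latitudeCDF`).

In dimension `n` and curvature `k`, the set where `ρ ≤ r` is the set where `√n` times the latitude
is at most `√(n * k) * r`. For `k = κ / n` this bound does not depend on `n`, which gives the limit
of the observable inscribed radii. For a general sequence of curvatures, the strips of every
positive width fill up the hemispheres in the limit if and only if `n * k` tends to infinity.
-/

/-! ### Inscribed radii as quantiles of the distance from the boundary -/

namespace MMSpaceWithBoundary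

lemma inRad_setOf_rho_le_le (X : MMSpaceWithBoundary) (r : ℝ≥0∞) :
    X.inRad {x | X.rho x ≤ r} ≤ r :=
  iSup₂_le fun _ hx => hx

lemma rho_le_inRad (X : MMSpaceWithBoundary) {Ω : Set X.carrier} {x : X.carrier} (hx : x ∈ Ω) :
    X.rho x ≤ X.inRad Ω :=
  le_iSup₂ (f := fun x (_ : x ∈ Ω) => X.rho x) x hx

lemma measurableSet_rho_le (X : MMSpaceWithBoundary) (r : ℝ≥0∞) :
    MeasurableSet {x | X.rho x ≤ r} :=
  measurable_infEDist measurableSet_Iic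

lemma partInRad_le_inRad (X : MMSpaceWithBoundary) {ξ : ℝ} {Ω : Set X.carrier}
    (hm : MeasurableSet Ω) (hξ : ξ ≤ X.μ.real Ω) : X.partInRad ξ ≤ X.inRad Ω :=
  iInf_le_of_le Ω (iInf₂_le hm hξ)

lemma partInRad_le (X : MMSpaceWithBoundary) {ξ : ℝ} {r : ℝ≥0∞}
    (h : ξ ≤ X.μ.real {x | X.rho x ≤ r}) : X.partInRad ξ ≤ r :=
  (X.partInRad_le_inRad (X.measurableSet_rho_le r) h).trans (X.inRad_setOf_rho_le_le r)

lemma le_partInRad (X : MMSpaceWithBoundary) {ξ : ℝ} {r : ℝ≥0∞}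
    (h : X.μ.real {x | X.rho x ≤ r} < ξ) : r ≤ X.partInRad ξ := by
  refine le_iInf fun Ω => le_iInf₂ fun _ hΩ => ?_
  by_contra! hlt
  refine absurd (hΩ.trans (measureReal_mono fun x hx => ?_)) h.not_ge
  exact (X.rho_le_inRad hx).trans hlt.le

lemma rho_screen (X : MMSpaceWithBoundary) (φ : X.carrier → ℝ≥0) (hφ : LipschitzWith 1 φ)
    (t : ℝ≥0) : (X.screen φ hφ).rho t = t := by
  change infEDist t {0} = t
  rw [infEDist_singleton, edist_nndist, NNReal.nndist_zero_eq_val']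

/-- A `1`-Lipschitz function vanishing on the boundary is dominated by the distance from the
boundary. -/
lemma coe_le_rho (X : MMSpaceWithBoundary) {φ : X.carrier → ℝ≥0} (hφ : LipschitzWith 1 φ)
    (h0 : ∀ x ∈ X.boundary, φ x = 0) (x : X.carrier) : (φ x : ℝ≥0∞) ≤ X.rho x := by
  refine le_infEDist.2 fun y hy => ?_
  have h := hφ x y
  rwa [h0 y hy, edist_nndist, NNReal.nndist_zero_eq_val', ENNReal.coe_one, one_mul] at h

/-- The distance from the boundary is the extremal screen function, so that the observable
inscribed radius is the partial inscribed radius of the space itself. -/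
lemma obsInRad_eq_partInRad (X : MMSpaceWithBoundary) (hX : X.boundary.Nonempty) (η : ℝ) :
    X.obsInRad η = X.partInRad (1 - η) := by
  apply le_antisymm
  · refine iSup_le fun φ => iSup₂_le fun hφ h0 => ?_
    refine le_iInf fun Ω => le_iInf₂ fun _ hΩ => ?_
    refine (X.screen φ hφ).partInRad_le (hΩ.trans ?_)
    change X.μ.real Ω ≤ (X.μ.map φ).real {t | (X.screen φ hφ).rho t ≤ X.inRad Ω}
    simp only [rho_screen]
    have hm : MeasurableSet {t : ℝ≥0 | (t : ℝ≥0∞) ≤ X.inRad Ω} :=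
      measurableSet_le (by fun_prop) measurable_const
    rw [map_measureReal_apply hφ.continuous.measurable hm]
    exact measureReal_mono fun x hx => (X.coe_le_rho hφ h0 x).trans (X.rho_le_inRad hx)
  · have hφ : LipschitzWith 1 fun x => infNndist x X.boundary :=
      lipschitz_infNndist_pt X.boundary
    have hcoe : ∀ x, (infNndist x X.boundary : ℝ≥0∞) = X.rho x := fun x =>
      ENNReal.coe_toNNReal (infEDist_ne_top hX)
    have h0 : ∀ x ∈ X.boundary, infNndist x X.boundary = 0 := fun x hx => by
      rw [← ENNReal.coe_eq_zero, hcoe]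
      exact infEDist_zero_of_mem hx
    refine le_iSup_of_le _ (le_iSup₂_of_le hφ h0 (le_iInf fun Ω => le_iInf₂ fun hm hΩ => ?_))
    refine (X.partInRad_le_inRad (hφ.continuous.measurable hm) ?_).trans
      (iSup₂_le fun x hx => ?_)
    · exact hΩ.trans (map_measureReal_apply hφ.continuous.measurable hm).le
    · have h := (X.screen _ hφ).rho_le_inRad hx
      rwa [rho_screen, hcoe] at h

/-- The partial inscribed radius is a quantile of the distance from the boundary. Hence it
converges if the distribution functions converge pointwise to a strictly increasing one. -/
lemma tendsto_partInRad {ι : Type*} {l : Filter ι} {X : ι → MMSpaceWithBoundary} {F : ℝ → ℝ}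
    (hF : StrictMonoOn F (Ici 0))
    (hX : ∀ r : ℝ≥0, Tendsto (fun i => (X i).μ.real {x | (X i).rho x ≤ r}) l (𝓝 (F r)))
    {r : ℝ≥0} : Tendsto (fun i => (X i).partInRad (F r)) l (𝓝 r) := by
  rw [tendsto_order]
  refine ⟨fun a ha => ?_, fun a ha => ?_⟩
  · obtain ⟨s, has, hsr⟩ := ENNReal.lt_iff_exists_nnreal_btwn.1 ha
    have hsr' : s < r := ENNReal.coe_lt_coe.1 hsr
    have h := (hX s).eventually_lt_const (hF s.2 r.2 (NNReal.coe_lt_coe.2 hsr'))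
    exact h.mono fun i hi => has.trans_le ((X i).le_partInRad hi)
  · obtain ⟨s, hrs, hsa⟩ := ENNReal.lt_iff_exists_nnreal_btwn.1 ha
    have hrs' : r < s := ENNReal.coe_lt_coe.1 hrs
    have h := (hX s).eventually_const_lt (hF r.2 s.2 (NNReal.coe_lt_coe.2 hrs'))
    exact h.mono fun i hi => ((X i).partInRad_le hi.le).trans_lt hsa

lemma partInRad_eq {X : MMSpaceWithBoundary} {F : ℝ → ℝ} (hF : StrictMonoOn F (Ici 0))
    (hX : ∀ r : ℝ≥0, X.μ.real {x | X.rho x ≤ r} = F r) (r : ℝ≥0) :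
    X.partInRad (F r) = r := by
  have h := tendsto_partInRad (ι := ℕ) (l := atTop) (X := fun _ => X) hF (r := r)
    fun s => by rw [hX s]; exact tendsto_const_nhds
  exact tendsto_nhds_unique tendsto_const_nhds h

end MMSpaceWithBoundary

/-! ### The half-Gaussian distribution function -/

/-- The distribution function on `[0, ∞)` of the half-Gaussian law with density proportional to
`exp (-(κ / 2) * t ^ 2)`. At negative arguments the formula gives the odd extension. -/
noncomputable def halfGaussianCDF (κ r : ℝ) : ℝ :=
  (∫ t in (0 : ℝ)..r, Real.exp (-(κ / 2) * t ^ 2)) /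
    ∫ t in Ici (0 : ℝ), Real.exp (-(κ / 2) * t ^ 2)

section HalfGaussianCDF

variable {κ : ℝ}

lemma integrable_exp_neg_half_mul_sq (hκ : 0 < κ) :
    Integrable fun t : ℝ => Real.exp (-(κ / 2) * t ^ 2) :=
  integrable_exp_neg_mul_sq (half_pos hκ)

lemma integral_Ici_exp_neg_half_mul_sq_pos (hκ : 0 < κ) :
    0 < ∫ t in Ici (0 : ℝ), Real.exp (-(κ / 2) * t ^ 2) := by
  have : NeZero (volume.restrict (Ici (0 : ℝ))) := ⟨by simp [Measure.restrict_eq_zero]⟩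
  exact integral_exp_pos (μ := volume.restrict (Ici (0 : ℝ)))
    (integrable_exp_neg_half_mul_sq hκ).integrableOn

lemma halfGaussianCDF_zero (κ : ℝ) : halfGaussianCDF κ 0 = 0 := by
  simp [halfGaussianCDF]

lemma strictMono_halfGaussianCDF (hκ : 0 < κ) : StrictMono (halfGaussianCDF κ) := by
  intro a b hab
  have hi := integrable_exp_neg_half_mul_sq hκ
  refine div_lt_div_of_pos_right ?_ (integral_Ici_exp_neg_half_mul_sq_pos hκ)
  rw [← sub_pos, intervalIntegral.integral_interval_sub_left hi.intervalIntegrable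
    hi.intervalIntegrable]
  exact intervalIntegral.intervalIntegral_pos_of_pos hi.intervalIntegrable
    (fun t => Real.exp_pos _) hab

lemma continuous_halfGaussianCDF (hκ : 0 < κ) : Continuous (halfGaussianCDF κ) :=
  (intervalIntegral.continuous_primitive
    (fun _ _ => (integrable_exp_neg_half_mul_sq hκ).intervalIntegrable) 0).div_const _

lemma tendsto_halfGaussianCDF_atTop (hκ : 0 < κ) :
    Tendsto (halfGaussianCDF κ) atTop (𝓝 1) := by
  have h := (intervalIntegral_tendsto_integral_Ioi 0
    (integrable_exp_neg_half_mul_sq hκ).integrableOn tendsto_id).div_const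
      (∫ t in Ici (0 : ℝ), Real.exp (-(κ / 2) * t ^ 2))
  rwa [← integral_Ici_eq_integral_Ioi,
    div_self (integral_Ici_exp_neg_half_mul_sq_pos hκ).ne'] at h

/-- The values of the distribution function on `[0, ∞)` fill up `[0, 1)`. -/
lemma exists_halfGaussianCDF_eq (hκ : 0 < κ) {ξ : ℝ} (h0 : 0 ≤ ξ) (h1 : ξ < 1) :
    ∃ r : ℝ≥0, halfGaussianCDF κ r = ξ := by
  obtain ⟨b, hb, hb0⟩ := (((tendsto_halfGaussianCDF_atTop hκ).eventually_const_lt h1).and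
    (eventually_ge_atTop 0)).exists
  obtain ⟨r, hr, hrξ⟩ := intermediate_value_Icc hb0 (continuous_halfGaussianCDF hκ).continuousOn
    ⟨(halfGaussianCDF_zero κ).trans_le h0, hb.le⟩
  exact ⟨⟨r, hr.1⟩, hrξ⟩

lemma halfGaussianCDF_eq_rescale (hκ : 0 < κ) (r : ℝ) :
    halfGaussianCDF κ r = halfGaussianCDF 1 (√κ * r) := by
  have hs : 0 < √κ := Real.sqrt_pos.2 hκ
  have hfun : ∀ t : ℝ, Real.exp (-(κ / 2) * t ^ 2) = Real.exp (-(1 / 2) * (√κ * t) ^ 2) :=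
    fun t => by rw [mul_pow, Real.sq_sqrt hκ.le]; ring_nf
  unfold halfGaussianCDF
  simp only [hfun]
  rw [intervalIntegral.integral_comp_mul_left (fun t => Real.exp (-(1 / 2) * t ^ 2)) hs.ne',
    integral_Ici_eq_integral_Ioi,
    integral_comp_mul_left_Ioi (fun t => Real.exp (-(1 / 2) * t ^ 2)) 0 hs,
    integral_Ici_eq_integral_Ioi, mul_zero, smul_eq_mul, smul_eq_mul,
    mul_div_mul_left _ _ (inv_pos.2 hs).ne']

/-- In terms of the standard Gaussian law, the half-Gaussian distribution function is a conditional
probability given positivity. -/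
lemma gaussianReal_Icc_div_Ici {a : ℝ} (ha : 0 ≤ a) :
    (ProbabilityTheory.gaussianReal 0 1).real (Icc 0 a) /
      (ProbabilityTheory.gaussianReal 0 1).real (Ici 0) = halfGaussianCDF 1 a := by
  have h : ∀ s : Set ℝ, MeasurableSet s → (ProbabilityTheory.gaussianReal 0 1).real s =
      (√(2 * Real.pi))⁻¹ * ∫ t in s, Real.exp (-(1 / 2) * t ^ 2) := fun s _ => by
    rw [measureReal_def, ProbabilityTheory.gaussianReal_apply_eq_integral 0 one_ne_zero,
      ENNReal.toReal_ofReal (integral_nonneg fun t =>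
        ProbabilityTheory.gaussianPDFReal_nonneg _ _ _), ← integral_const_mul]
    refine integral_congr_ae (Eventually.of_forall fun t => ?_)
    simp only [ProbabilityTheory.gaussianPDFReal, NNReal.coe_one, mul_one, sub_zero]
    ring_nf
  rw [h _ measurableSet_Icc, h _ measurableSet_Ici, mul_div_mul_left _ _ (by positivity),
    integral_Icc_eq_integral_Ioc, ← intervalIntegral.integral_of_le ha]
  rfl

lemma halfGaussian_real_setOf_rho_le (hκ : 0 < κ) (r : ℝ≥0) :
    (halfGaussian κ 0 hκ).μ.real {t | (halfGaussian κ 0 hκ).rho t ≤ r} = halfGaussianCDF κ r := by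
  have hrho : ∀ t : ℝ≥0, (halfGaussian κ 0 hκ).rho t = t := fun t => by
    change infEDist t {0} = t
    rw [infEDist_singleton, edist_nndist, NNReal.nndist_zero_eq_val']
  have hset : {t : ℝ≥0 | (halfGaussian κ 0 hκ).rho t ≤ r} = Iic r := by
    ext t
    simp [hrho]
  have he : MeasurableEmbedding ((↑) : ℝ≥0 → ℝ) :=
    MeasurableEmbedding.subtype_coe measurableSet_Ici
  have hpre : Iic r = ((↑) : ℝ≥0 → ℝ) ⁻¹' Iic (r : ℝ) := by
    ext t
    simp
  have hrange : range ((↑) : ℝ≥0 → ℝ) = Ici 0 := Subtype.range_coe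
  have hdens : ∀ t, halfGaussianDensity κ 0 t = Real.exp (-(κ / 2) * t ^ 2) /
      ∫ s in Ici (0 : ℝ), Real.exp (-(κ / 2) * s ^ 2) := fun t => by
    simp [halfGaussianDensity]
  change (halfGaussianMeasure κ 0).real {t : ℝ≥0 | (halfGaussian κ 0 hκ).rho t ≤ r} = _
  rw [hset, measureReal_def, halfGaussianMeasure, withDensity_apply _ measurableSet_Iic,
    ← he.lintegral_map (μ := (volume.comap ((↑) : ℝ≥0 → ℝ)).restrict (Iic r))
      (fun t => ENNReal.ofReal (halfGaussianDensity κ 0 t)),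
    hpre, ← he.restrict_map, he.map_comap, hrange, Measure.restrict_restrict measurableSet_Iic,
    inter_comm, Ici_inter_Iic]
  simp only [hdens]
  rw [← ofReal_integral_eq_lintegral_ofReal, ENNReal.toReal_ofReal, integral_div,
    integral_Icc_eq_integral_Ioc, ← intervalIntegral.integral_of_le r.coe_nonneg]
  · rfl
  · exact integral_nonneg fun t => div_nonneg (Real.exp_pos _).le
      (integral_Ici_exp_neg_half_mul_sq_pos hκ).le
  · exact ((integrable_exp_neg_half_mul_sq hκ).div_const _).integrableOn
  · exact Eventually.of_forall fun t => div_nonneg (Real.exp_pos _).le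
      (integral_Ici_exp_neg_half_mul_sq_pos hκ).le

end HalfGaussianCDF

/-! ### Directions of Gaussian vectors -/

/-- Polar coordinates for a radial density over the cone spanned by a subset of the unit sphere. -/
lemma setLIntegral_cone_radial {E : Type*} [NormedAddCommGroup E] [NormedSpace ℝ E]
    [MeasurableSpace E] [BorelSpace E] [FiniteDimensional ℝ E] (μ : Measure E)
    [μ.IsAddHaarMeasure] {h : ℝ → ℝ≥0∞} (hh : Measurable h) (A : Set (sphere (0 : E) 1)) :
    ∫⁻ x in (↑) '' (homeomorphUnitSphereProd E ⁻¹' (A ×ˢ univ)), h ‖x‖ ∂μ =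
      μ.toSphere A * ∫⁻ r : Ioi (0 : ℝ), h r ∂(Measure.volumeIoiPow (Module.finrank ℝ E - 1)) := by
  have hmp := μ.measurePreserving_homeomorphUnitSphereProd
  rw [← setLIntegral_subtype (measurableSet_singleton 0).compl _ fun x => h ‖x‖]
  have h1 : ∀ x : ({0}ᶜ : Set E), h ‖(x : E)‖ = h (homeomorphUnitSphereProd E x).2 := fun x => by
    simp
  simp only [h1]
  rw [hmp.setLIntegral_comp_preimage_emb (Homeomorph.measurableEmbedding _)
    (fun p : sphere (0 : E) 1 × Ioi (0 : ℝ) => h p.2), ← Measure.prod_restrict,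
    Measure.restrict_univ]
  have h2 := lintegral_prod_mul (μ := μ.toSphere.restrict A)
    (ν := Measure.volumeIoiPow (Module.finrank ℝ E - 1)) (f := fun _ => 1)
    (g := fun r : Ioi (0 : ℝ) => h r) aemeasurable_const (by fun_prop)
  simpa using h2

namespace ProbabilityTheory

lemma pi_gaussianReal_eq_withDensity (ι : Type*) [Fintype ι] :
    Measure.pi (fun _ : ι => gaussianReal 0 1) = volume.withDensity
      fun x : ι → ℝ => ENNReal.ofReal (∏ i, gaussianPDFReal 0 1 (x i)) := by
  refine Measure.pi_eq fun s hs => ?_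
  rw [withDensity_apply _ (MeasurableSet.univ_pi hs), volume_pi, Measure.restrict_pi_pi,
    ← ofReal_integral_eq_lintegral_ofReal, integral_fintype_prod_eq_prod,
    ENNReal.ofReal_prod_of_nonneg]
  · exact Finset.prod_congr rfl fun i _ =>
      (gaussianReal_apply_eq_integral 0 one_ne_zero (s i)).symm
  · exact fun i _ => integral_nonneg fun t => gaussianPDFReal_nonneg _ _ _
  · exact Integrable.fintype_prod fun i => (integrable_gaussianPDFReal 0 1).integrableOn
  · exact Eventually.of_forall fun x => Finset.prod_nonneg fun i _ => gaussianPDFReal_nonneg _ _ _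

lemma stdGaussian_apply {ι : Type*} [Fintype ι] {A : Set (EuclideanSpace ℝ ι)}
    (hA : MeasurableSet A) : stdGaussian (EuclideanSpace ℝ ι) A =
      ∫⁻ x in A, ENNReal.ofReal ((√(2 * Real.pi))⁻¹ ^ Fintype.card ι *
        Real.exp (-‖x‖ ^ 2 / 2)) := by
  have hmp := PiLp.volume_preserving_toLp ι
  rw [← map_pi_eq_stdGaussian, Measure.map_apply hmp.measurable hA,
    pi_gaussianReal_eq_withDensity, withDensity_apply _ (hmp.measurable hA),
    ← hmp.setLIntegral_comp_preimage hA (by fun_prop)]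
  refine lintegral_congr fun x => ?_
  simp only [gaussianPDFReal, NNReal.coe_one, mul_one, sub_zero, Finset.prod_mul_distrib,
    Finset.prod_const, Finset.card_univ, ← Real.exp_sum, EuclideanSpace.real_norm_sq_eq,
    ← Finset.sum_neg_distrib, Finset.sum_div]

lemma stdGaussian_singleton_zero (ι : Type*) [Fintype ι] [Nonempty ι] :
    stdGaussian (EuclideanSpace ℝ ι) {0} = 0 := by
  rw [stdGaussian_apply (measurableSet_singleton 0)]
  exact setLIntegral_measure_zero _ _ (measure_singleton _)

/-- The direction of a standard Gaussian vector is uniformly distributed on the unit sphere: the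
Gaussian measure of a cone is proportional to the surface measure of its trace on the sphere. -/
lemma exists_stdGaussian_cone_eq (ι : Type*) [Fintype ι] [Nonempty ι] :
    ∃ c : ℝ≥0∞, c ≠ 0 ∧ c ≠ ∞ ∧ ∀ B : Set (EuclideanSpace ℝ ι), MeasurableSet B →
      (∀ x ≠ 0, ‖x‖⁻¹ • x ∈ B ↔ x ∈ B) →
      stdGaussian (EuclideanSpace ℝ ι) B = (volume : Measure (EuclideanSpace ℝ ι)).toSphere
        ((↑) ⁻¹' B) * c := by
  set E := EuclideanSpace ℝ ι
  set c : ℝ≥0∞ := ∫⁻ r : Ioi (0 : ℝ), ENNReal.ofReal ((√(2 * Real.pi))⁻¹ ^ Fintype.card ι *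
        Real.exp (-r.1 ^ 2 / 2)) ∂(Measure.volumeIoiPow (Module.finrank ℝ E - 1))
  have hc : ∀ B : Set E, MeasurableSet B → (∀ x ≠ 0, ‖x‖⁻¹ • x ∈ B ↔ x ∈ B) →
      stdGaussian E B = (volume : Measure E).toSphere ((↑) ⁻¹' B) * c := fun B hB hcone => by
    have himage : (↑) '' (homeomorphUnitSphereProd E ⁻¹' (((↑) ⁻¹' B) ×ˢ univ)) = B \ {0} := by
      ext x
      constructor
      · rintro ⟨⟨y, hy⟩, hyB, rfl⟩
        have h : ‖y‖⁻¹ • y ∈ B := by simpa using hyB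
        exact ⟨(hcone y hy).1 h, hy⟩
      · rintro ⟨hxB, hx⟩
        exact ⟨⟨x, hx⟩, by simpa using (hcone x hx).2 hxB, rfl⟩
    -- Polar coordinates miss the origin, which is a null set.
    rw [← measure_sdiff_null (stdGaussian_singleton_zero ι),
      stdGaussian_apply (hB.diff (measurableSet_singleton 0)), ← himage]
    exact setLIntegral_cone_radial volume (h := fun r => ENNReal.ofReal
      ((√(2 * Real.pi))⁻¹ ^ Fintype.card ι * Real.exp (-r ^ 2 / 2))) (by fun_prop) _
  have h1 : (volume : Measure E).toSphere univ * c = 1 := by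
    rw [← preimage_univ, ← hc univ .univ (by simp), measure_univ]
  have h2 : (volume : Measure E).toSphere univ ≠ 0 := fun h => by simp [h] at h1
  refine ⟨c, fun h => by simp [h] at h1, fun h => ?_, hc⟩
  rw [h, ENNReal.mul_top h2] at h1
  exact ENNReal.top_ne_one h1

end ProbabilityTheory

/-! ### The latitude of a Gaussian vector in high dimension -/

namespace ProbabilityTheory

/-- The law of an infinite sequence of independent standard Gaussian variables. -/
noncomputable def gaussianSequence : Measure (ℕ → ℝ) :=
  Measure.infinitePi fun _ => gaussianReal 0 1

instance : IsProbabilityMeasure gaussianSequence :=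
  inferInstanceAs (IsProbabilityMeasure (Measure.infinitePi fun _ => gaussianReal 0 1))

lemma gaussianSequence_map_eval (i : ℕ) :
    gaussianSequence.map (fun ω => ω i) = gaussianReal 0 1 :=
  Measure.infinitePi_map_eval _ i

/-- The first `n + 1` variables form a standard Gaussian vector. They are listed backwards so that
the last coordinate is the same variable for all `n`. -/
lemma gaussianSequence_map_rev (n : ℕ) :
    gaussianSequence.map (fun ω => WithLp.toLp 2 fun i : Fin (n + 1) => ω i.rev) =
      stdGaussian (EuclideanSpace ℝ (Fin (n + 1))) := by
  have hinj : Function.Injective fun i : Fin (n + 1) => (i.rev : ℕ) :=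
    Fin.val_injective.comp Fin.rev_injective
  have hind := (iIndepFun_infinitePi (P := fun _ : ℕ => gaussianReal 0 1)
    (X := fun _ t => t) (fun _ => measurable_id)).precomp hinj
  have h := (iIndepFun_iff_map_fun_eq_pi_map
    (fun i => (measurable_pi_apply _).aemeasurable)).1 hind
  simp only [Measure.infinitePi_map_eval] at h
  rw [← map_pi_eq_stdGaussian, ← h, Measure.map_map (by fun_prop) (by fun_prop)]
  rfl

lemma norm_toLp_rev (n : ℕ) (ω : ℕ → ℝ) :
    ‖(WithLp.toLp 2 fun i : Fin (n + 1) => ω i.rev : EuclideanSpace ℝ (Fin (n + 1)))‖ =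
      √(∑ i ∈ Finset.range (n + 1), ω i ^ 2) := by
  rw [EuclideanSpace.norm_eq, Finset.sum_range]
  congr 1
  simp only [Real.norm_eq_abs, sq_abs]
  exact Equiv.sum_comp Fin.revPerm fun i : Fin (n + 1) => ω i ^ 2

lemma ae_tendsto_sum_sq_div :
    ∀ᵐ ω : ℕ → ℝ ∂gaussianSequence,
      Tendsto (fun n : ℕ => (∑ i ∈ Finset.range n, ω i ^ 2) / (n : ℝ)) atTop (𝓝 1) := by
  have hmap := gaussianSequence_map_eval
  have hmem : MemLp (fun x : ℝ => x) 2 (gaussianReal 0 1) := memLp_id_gaussianReal 2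
  have hind : iIndepFun (fun (i : ℕ) (ω : ℕ → ℝ) => ω i ^ 2) gaussianSequence :=
    iIndepFun_infinitePi (P := fun _ : ℕ => gaussianReal 0 1)
      (X := fun _ t => t ^ 2) (fun _ => by fun_prop)
  have hint : Integrable (fun ω : ℕ → ℝ => ω 0 ^ 2) gaussianSequence := by
    have h := hmem.integrable_sq
    rw [← hmap 0] at h
    exact h.comp_measurable (measurable_pi_apply 0)
  have hident : ∀ i, IdentDistrib (fun ω : ℕ → ℝ => ω i ^ 2) (fun ω => ω 0 ^ 2)
      gaussianSequence gaussianSequence := fun i =>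
    IdentDistrib.comp (u := fun t : ℝ => t ^ 2)
      ⟨(measurable_pi_apply i).aemeasurable, (measurable_pi_apply 0).aemeasurable,
        (hmap i).trans (hmap 0).symm⟩ (by fun_prop)
  have hmean : ∫ ω, ω 0 ^ 2 ∂gaussianSequence = 1 := by
    have h := integral_map (μ := gaussianSequence) (φ := fun ω : ℕ → ℝ => ω 0)
      (f := fun t : ℝ => t ^ 2) (measurable_pi_apply 0).aemeasurable (by fun_prop)
    rw [← h, hmap]
    have hv := variance_fun_id_gaussianReal (μ := 0) (v := 1)
    rwa [variance_of_integral_eq_zero (by fun_prop) integral_id_gaussianReal, NNReal.coe_one]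
      at hv
  have h := strong_law_ae_real (fun (i : ℕ) (ω : ℕ → ℝ) => ω i ^ 2) hint
    (fun i j hij => hind.indepFun hij) hident
  rwa [hmean] at h

/-- The latitude of a Gaussian vector in dimension `n + 1`, multiplied by `√n`, converges to its
last coordinate. -/
lemma ae_tendsto_sqrt_mul_arcsin :
    ∀ᵐ ω ∂gaussianSequence, Tendsto (fun n : ℕ =>
      √n * Real.arcsin (ω 0 / √(∑ i ∈ Finset.range (n + 1), ω i ^ 2))) atTop (𝓝 (ω 0)) := by
  filter_upwards [ae_tendsto_sum_sq_div] with ω hω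
  set x : ℕ → ℝ := fun n => ω 0 / √(∑ i ∈ Finset.range (n + 1), ω i ^ 2)
  have h1 : Tendsto (fun n : ℕ => (n : ℝ) / ∑ i ∈ Finset.range (n + 1), ω i ^ 2)
      atTop (𝓝 1) := by
    have h := (tendsto_natCast_div_add_atTop (1 : ℝ)).div
      (hω.comp (tendsto_add_atTop_nat 1)) one_ne_zero
    rw [div_one] at h
    refine h.congr fun n => ?_
    simp only [Pi.div_apply, Function.comp_apply, Nat.cast_add, Nat.cast_one]
    have : (n : ℝ) + 1 ≠ 0 := by positivity
    field_simp
  have h2 : Tendsto (fun n : ℕ => √n * x n) atTop (𝓝 (ω 0)) := by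
    have h := h1.sqrt.const_mul (ω 0)
    rw [Real.sqrt_one, mul_one] at h
    refine h.congr fun n => ?_
    rw [Real.sqrt_div (by positivity)]
    ring
  have h3 : Tendsto x atTop (𝓝 0) := by
    have h : Tendsto (fun n : ℕ => (√(n : ℝ))⁻¹) atTop (𝓝 0) :=
      (Real.tendsto_sqrt_atTop.comp tendsto_natCast_atTop_atTop).inv_tendsto_atTop
    have h' := h.mul h2
    rw [zero_mul] at h'
    refine h'.congr' ?_
    filter_upwards [eventually_gt_atTop 0] with n hn
    have : √(n : ℝ) ≠ 0 := by positivity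
    field_simp
  have hderiv : HasDerivAt Real.arcsin 1 0 := by
    simpa using Real.hasDerivAt_arcsin (x := 0) (by norm_num) (by norm_num)
  have h4 : Tendsto (fun n => dslope Real.arcsin 0 (x n)) atTop (𝓝 1) := by
    have h : ContinuousAt (dslope Real.arcsin 0) 0 :=
      continuousAt_dslope_same.2 hderiv.differentiableAt
    have h' := h.tendsto.comp h3
    rwa [dslope_same, hderiv.deriv] at h'
  have h5 := h2.mul h4
  rw [mul_one] at h5
  refine h5.congr fun n => ?_
  have h := sub_smul_dslope Real.arcsin 0 (x n)
  rw [Real.arcsin_zero, sub_zero, sub_zero, smul_eq_mul] at h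
  rw [mul_assoc, h]

lemma tendsto_gaussianSequence_latitude (a : ℝ) :
    Tendsto (fun n : ℕ => gaussianSequence {ω | 0 ≤ ω 0 ∧
        √n * Real.arcsin (ω 0 / √(∑ i ∈ Finset.range (n + 1), ω i ^ 2)) ≤ a})
      atTop (𝓝 (gaussianReal 0 1 (Icc 0 a))) := by
  have h0 : gaussianReal 0 1 (Icc 0 a) = gaussianSequence {ω | 0 ≤ ω 0 ∧ ω 0 ≤ a} := by
    rw [← gaussianSequence_map_eval 0, Measure.map_apply (by fun_prop) measurableSet_Icc]
    rfl
  have hne : ∀ᵐ ω ∂gaussianSequence, ω 0 ≠ a := by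
    have := nullSingletonClass_gaussianReal (μ := 0) (one_ne_zero (α := ℝ≥0))
    have h : ∀ᵐ t ∂gaussianReal 0 1, t ≠ a := compl_mem_ae_iff.2 (measure_singleton a)
    rw [← gaussianSequence_map_eval 0] at h
    exact ae_of_ae_map (measurable_pi_apply 0).aemeasurable h
  rw [h0]
  refine tendsto_measure_of_ae_tendsto_indicator_of_isFiniteMeasure _
    (by measurability) (fun n => ?_) ?_
  · have h : Measurable fun ω : ℕ → ℝ =>
        √n * Real.arcsin (ω 0 / √(∑ i ∈ Finset.range (n + 1), ω i ^ 2)) :=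
      (Real.measurable_arcsin.comp (by fun_prop)).const_mul _
    exact (measurableSet_le measurable_const (measurable_pi_apply 0)).inter
      (measurableSet_le h measurable_const)
  · filter_upwards [ae_tendsto_sqrt_mul_arcsin, hne] with ω hω hωa
    rcases hωa.lt_or_gt with h | h
    · filter_upwards [hω.eventually_lt_const h] with n hn
      exact and_congr_right fun _ => iff_of_true hn.le h.le
    · filter_upwards [hω.eventually_const_lt h] with n hn
      exact and_congr_right fun _ => iff_of_false hn.not_ge h.not_ge

end ProbabilityTheory

/-! ### The distance from the equator of a hemisphere -/

open ProbabilityTheory in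
/-- The distribution function of the latitude of a uniformly distributed point of the unit
hemisphere of dimension `n`, multiplied by `√n`. The point is represented as the direction of a
standard Gaussian vector conditioned to have a nonnegative last coordinate; the value `0` given to
the zero vector by `ω 0 / 0 = 0` does not matter, as this vector has probability zero. -/
noncomputable def latitudeCDF (n : ℕ) (a : ℝ) : ℝ :=
  gaussianSequence.real {ω | 0 ≤ ω 0 ∧
    √n * Real.arcsin (ω 0 / √(∑ i ∈ Finset.range (n + 1), ω i ^ 2)) ≤ a} /
  (gaussianReal 0 1).real (Ici 0)

lemma monotone_latitudeCDF (n : ℕ) : Monotone (latitudeCDF n) := fun _ _ hab =>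
  div_le_div_of_nonneg_right (measureReal_mono fun _ hω => ⟨hω.1, hω.2.trans hab⟩)
    measureReal_nonneg

/-- The Maxwell–Boltzmann law for the latitude. -/
lemma tendsto_latitudeCDF {a : ℝ} (ha : 0 ≤ a) :
    Tendsto (fun n : ℕ => latitudeCDF n a) atTop (𝓝 (halfGaussianCDF 1 a)) := by
  rw [← gaussianReal_Icc_div_Ici ha]
  exact ((ENNReal.tendsto_toReal (measure_ne_top _ _)).comp
    (ProbabilityTheory.tendsto_gaussianSequence_latitude a)).div_const _

namespace UnitHemisphere

variable {n : ℕ}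

lemma arc_eq_arccos_inner (x y : UnitHemisphere n) :
    arc x y = Real.arccos (inner ℝ x.toVec y.toVec) := by
  rw [arc, InnerProductGeometry.angle, norm_toVec, norm_toVec, mul_one, div_one]

lemma arcsin_le_arc (x y : UnitHemisphere n) (hy : y.toVec (Fin.last n) = 0) :
    Real.arcsin (x.toVec (Fin.last n)) ≤ arc x y := by
  -- The triangle inequality through the pole, which is at distance `π / 2` from the equator.
  set e : EuclideanSpace ℝ (Fin (n + 1)) := EuclideanSpace.single (Fin.last n) 1 with he
  have hangle : ∀ z : UnitHemisphere n,
      InnerProductGeometry.angle z.toVec e = Real.arccos (z.toVec (Fin.last n)) := fun z => by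
    rw [InnerProductGeometry.angle, norm_toVec]
    simp [he, EuclideanSpace.inner_single_right]
  have h := InnerProductGeometry.angle_le_angle_add_angle y.toVec x.toVec e
  rw [hangle, hangle, hy, Real.arccos_zero, InnerProductGeometry.angle_comm,
    Real.arccos_eq_pi_div_two_sub_arcsin] at h
  unfold arc
  linarith

lemma exists_toVec_eq {v : EuclideanSpace ℝ (Fin (n + 1))} (hv : ‖v‖ = 1)
    (h0 : v (Fin.last n) = 0) : ∃ y : UnitHemisphere n, y.toVec = v :=
  ⟨⟨⟨v, by simpa using hv⟩, h0.ge⟩, rfl⟩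

lemma exists_equator_point (hn : n ≠ 0) :
    ∃ y : UnitHemisphere n, y.toVec = EuclideanSpace.single 0 1 ∧ y.toVec (Fin.last n) = 0 := by
  have h : (EuclideanSpace.single (0 : Fin (n + 1)) (1 : ℝ)) (Fin.last n) = 0 := by
    have : (Fin.last n) ≠ 0 := by simpa [Fin.ext_iff] using hn
    simp [this]
  obtain ⟨y, hy⟩ := exists_toVec_eq (by simp) h
  exact ⟨y, hy, hy ▸ h⟩

/-- The foot of the meridian through a point realizes its distance from the equator. -/
lemma exists_arc_eq_arcsin (hn : n ≠ 0) (x : UnitHemisphere n) :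
    ∃ y : UnitHemisphere n, y.toVec (Fin.last n) = 0 ∧
      arc x y = Real.arcsin (x.toVec (Fin.last n)) := by
  set e : EuclideanSpace ℝ (Fin (n + 1)) := EuclideanSpace.single (Fin.last n) 1 with he
  set t := x.toVec (Fin.last n) with ht
  have ht0 : 0 ≤ t := x.2
  set p := x.toVec - t • e with hp
  have hpl : p (Fin.last n) = 0 := by simp [hp, he, ← ht]
  have hxe : inner ℝ x.toVec e = t := by
    simp [he, ht, EuclideanSpace.inner_single_right]
  have hee : inner ℝ e e = 1 := by simp [he]
  have hxx : inner ℝ x.toVec x.toVec = 1 := by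
    rw [real_inner_self_eq_norm_sq, norm_toVec, one_pow]
  have hxp : inner ℝ x.toVec p = 1 - t ^ 2 := by
    rw [hp, inner_sub_right, inner_smul_right, hxx, hxe, sq]
  have hpp : ‖p‖ ^ 2 = 1 - t ^ 2 := by
    rw [← real_inner_self_eq_norm_sq]
    nth_rw 1 [hp]
    rw [inner_sub_left, hxp, inner_smul_left, hp, inner_sub_right, inner_smul_right, hee,
      real_inner_comm, hxe]
    simp
  rcases eq_or_ne p 0 with h0 | h0
  · -- At the pole every point of the equator will do.
    obtain ⟨y, hy, hyl⟩ := exists_equator_point hn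
    refine ⟨y, hyl, ?_⟩
    have ht1 : t = 1 := by
      rw [h0, norm_zero] at hpp
      nlinarith
    have hxv : x.toVec = t • e := sub_eq_zero.1 h0
    have hey : inner ℝ e y.toVec = 0 := by
      rw [he, EuclideanSpace.inner_single_left, hyl, mul_zero]
    rw [arc_eq_arccos_inner, hxv, inner_smul_left, hey, mul_zero, Real.arccos_zero, ht1,
      Real.arcsin_one]
  · have hp0 : ‖p‖ ≠ 0 := norm_ne_zero_iff.2 h0
    have hvl : (‖p‖⁻¹ • p) (Fin.last n) = 0 := by
      rw [PiLp.smul_apply, hpl, smul_zero]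
    obtain ⟨y, hy⟩ := exists_toVec_eq (v := ‖p‖⁻¹ • p)
      (by rw [norm_smul, norm_inv, norm_norm, inv_mul_cancel₀ hp0]) hvl
    refine ⟨y, hy ▸ hvl, ?_⟩
    rw [arc_eq_arccos_inner, hy, inner_smul_right, hxp, ← hpp, sq, inv_mul_cancel_left₀ hp0,
      Real.arcsin_eq_arccos ht0, ← hpp, Real.sqrt_sq (norm_nonneg p)]

lemma surfaceMeasure_apply (S : Set (UnitHemisphere n)) :
    surfaceMeasure n S = (volume : Measure (EuclideanSpace ℝ (Fin (n + 1)))).toSphere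
      (Subtype.val '' S) :=
  (MeasurableEmbedding.subtype_coe (measurableSet_range_val n)).comap_apply _ S

end UnitHemisphere

lemma hemisphere_boundary_nonempty (n : ℕ+) (κ : ℝ) (hκ : 0 < κ) :
    (hemisphere n κ hκ).boundary.Nonempty := by
  obtain ⟨y, _, hy⟩ := UnitHemisphere.exists_equator_point n.ne_zero
  exact ⟨y, hy⟩

lemma rho_hemisphere (n : ℕ+) (κ : ℝ) (hκ : 0 < κ) (x : UnitHemisphere n) :
    (hemisphere n κ hκ).rho x =
      ENNReal.ofReal ((√κ)⁻¹ * Real.arcsin (x.toVec (Fin.last n))) := by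
  have hedist : ∀ y : UnitHemisphere n, @edist (hemisphere n κ hκ).carrier _ x y =
      ENNReal.ofReal ((√κ)⁻¹ * UnitHemisphere.arc x y) := fun y =>
    edist_dist (α := (hemisphere n κ hκ).carrier) x y
  apply le_antisymm
  · obtain ⟨y, hy, hxy⟩ := UnitHemisphere.exists_arc_eq_arcsin n.ne_zero x
    rw [← hxy, ← hedist]
    exact infEDist_le_edist_of_mem (α := (hemisphere n κ hκ).carrier) hy
  · refine le_infEDist.2 fun y hy => ?_
    refine (ENNReal.ofReal_le_ofReal ?_).trans_eq (hedist y).symm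
    exact mul_le_mul_of_nonneg_left (UnitHemisphere.arcsin_le_arc x y hy) (by positivity)

open ProbabilityTheory in
lemma hemisphere_real_setOf_rho_le (n : ℕ+) (κ : ℝ) (hκ : 0 < κ) (r : ℝ≥0) :
    (hemisphere n κ hκ).μ.real {x | (hemisphere n κ hκ).rho x ≤ r} =
      latitudeCDF n (√(n * κ) * r) := by
  have hs : 0 < √κ := Real.sqrt_pos.2 hκ
  have hsn : 0 < √(n : ℝ) := Real.sqrt_pos.2 (Nat.cast_pos.2 n.pos)
  -- The cones over the strip along the equator and over the hemisphere.
  set B : Set (EuclideanSpace ℝ (Fin (n + 1))) := {x | 0 ≤ x (Fin.last n) ∧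
    √(n : ℝ) * Real.arcsin (x (Fin.last n) / ‖x‖) ≤ √(n * κ) * r} with hB
  set C : Set (EuclideanSpace ℝ (Fin (n + 1))) := {x | 0 ≤ x (Fin.last n)} with hC
  have hCm : MeasurableSet C := measurableSet_le measurable_const (by fun_prop)
  have hBm : MeasurableSet B := by
    have h : Measurable fun x : EuclideanSpace ℝ (Fin (n + 1)) =>
        √(n : ℝ) * Real.arcsin (x (Fin.last n) / ‖x‖) :=
      (Real.measurable_arcsin.comp (by fun_prop)).const_mul _
    exact hCm.inter (measurableSet_le h measurable_const)
  have hCcone : ∀ x ≠ 0, ‖x‖⁻¹ • x ∈ C ↔ x ∈ C := fun x hx => by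
    have : 0 < ‖x‖⁻¹ := inv_pos.2 (norm_pos_iff.2 hx)
    simp only [hC, mem_ofPred_eq, PiLp.smul_apply, smul_eq_mul]
    exact mul_nonneg_iff_of_pos_left this
  have hBcone : ∀ x ≠ 0, ‖x‖⁻¹ • x ∈ B ↔ x ∈ B := fun x hx => by
    have hx' : ‖x‖ ≠ 0 := norm_ne_zero_iff.2 hx
    refine and_congr (hCcone x hx) ?_
    rw [norm_smul, norm_inv, norm_norm, inv_mul_cancel₀ hx', PiLp.smul_apply, smul_eq_mul, div_one,
      inv_mul_eq_div]
  obtain ⟨c, hc0, hc, hcone⟩ := exists_stdGaussian_cone_eq (Fin (n + 1))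
  have hset : {x : UnitHemisphere n | (hemisphere n κ hκ).rho x ≤ r} =
      {x | √(n : ℝ) * Real.arcsin (x.toVec (Fin.last n)) ≤ √(n * κ) * r} := by
    ext x
    rw [mem_ofPred_eq, mem_ofPred_eq, rho_hemisphere, ENNReal.ofReal_le_coe,
      Real.sqrt_mul (Nat.cast_nonneg _), mul_assoc, mul_le_mul_iff_right₀ hsn,
      inv_mul_le_iff₀ hs]
  have hnum : UnitHemisphere.surfaceMeasure n
      {x : UnitHemisphere n | (hemisphere n κ hκ).rho x ≤ r} =
      (volume : Measure (EuclideanSpace ℝ (Fin (n + 1)))).toSphere ((↑) ⁻¹' B) := by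
    rw [UnitHemisphere.surfaceMeasure_apply, hset]
    congr 1
    ext y
    have hy : ‖(y : EuclideanSpace ℝ (Fin (n + 1)))‖ = 1 := by simp
    simp only [hB, mem_preimage, mem_ofPred_eq, hy, div_one]
    constructor
    · rintro ⟨x, hx, rfl⟩
      exact ⟨x.2, hx⟩
    · exact fun h => ⟨⟨y, h.1⟩, h.2, rfl⟩
  have hden : UnitHemisphere.surfaceMeasure n univ =
      (volume : Measure (EuclideanSpace ℝ (Fin (n + 1)))).toSphere ((↑) ⁻¹' C) :=
    UnitHemisphere.surfaceMeasure_univ n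
  have hmapm : Measurable fun ω : ℕ → ℝ =>
      (WithLp.toLp 2 fun i : Fin (n + 1) => ω i.rev : EuclideanSpace ℝ (Fin (n + 1))) := by
    fun_prop
  have hgB : stdGaussian (EuclideanSpace ℝ (Fin (n + 1))) B = gaussianSequence {ω | 0 ≤ ω 0 ∧
      √n * Real.arcsin (ω 0 / √(∑ i ∈ Finset.range (n + 1), ω i ^ 2)) ≤ √(n * κ) * r} := by
    rw [← gaussianSequence_map_rev, Measure.map_apply hmapm hBm]
    simp only [hB, preimage_ofPred_eq, norm_toLp_rev, Fin.rev_last, Fin.val_zero]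
  have hgC : stdGaussian (EuclideanSpace ℝ (Fin (n + 1))) C = gaussianReal 0 1 (Ici 0) := by
    rw [← gaussianSequence_map_rev, Measure.map_apply hmapm hCm, ← gaussianSequence_map_eval 0,
      Measure.map_apply (measurable_pi_apply 0) measurableSet_Ici]
    simp only [hC, preimage_ofPred_eq, Fin.rev_last, Fin.val_zero]
    rfl
  change (((UnitHemisphere.surfaceMeasure n univ)⁻¹ • UnitHemisphere.surfaceMeasure n)
    {x : UnitHemisphere n | (hemisphere n κ hκ).rho x ≤ r}).toReal = _
  rw [Measure.smul_apply, smul_eq_mul, hnum, hden, latitudeCDF, measureReal_def, measureReal_def,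
    ← hgB, ← hgC, hcone B hBm hBcone, hcone C hCm hCcone, ENNReal.toReal_mul, ENNReal.toReal_mul,
    ENNReal.toReal_mul, ENNReal.toReal_inv,
    mul_div_mul_right _ _ (ENNReal.toReal_pos hc0 hc).ne', inv_mul_eq_div]

/-! ### Limits of the inscribed radii of hemispheres -/

lemma tendsto_pnat_latitudeCDF {a : ℝ} (ha : 0 ≤ a) :
    Tendsto (fun n : ℕ+ => latitudeCDF n a) atTop (𝓝 (halfGaussianCDF 1 a)) :=
  (tendsto_latitudeCDF ha).comp tendsto_PNat_val_atTop_atTop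

lemma tendsto_hemisphere_partInRad {κ : ℝ} (hκ : 0 < κ) (r : ℝ≥0) :
    Tendsto (fun n : ℕ+ => (hemisphere n (κ / (n : ℝ))
      (div_pos hκ (Nat.cast_pos.mpr n.pos))).partInRad (halfGaussianCDF κ r)) atTop (𝓝 r) := by
  refine MMSpaceWithBoundary.tendsto_partInRad
    ((strictMono_halfGaussianCDF hκ).strictMonoOn _) fun s => ?_
  rw [halfGaussianCDF_eq_rescale hκ]
  refine (tendsto_pnat_latitudeCDF (by positivity)).congr fun n => ?_
  rw [hemisphere_real_setOf_rho_le, mul_div_cancel₀ _ (Nat.cast_ne_zero.2 n.ne_zero)]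

lemma isBoundaryConcentrationFamily_hemisphere_iff {κ : ℕ+ → ℝ} (hκ : ∀ n, 0 < κ n) :
    IsBoundaryConcentrationFamily (fun n => hemisphere n (κ n) (hκ n)) ↔
      Tendsto (fun n : ℕ+ => (n : ℝ) * κ n) atTop atTop := by
  simp only [IsBoundaryConcentrationFamily,
    MMSpaceWithBoundary.obsInRad_eq_partInRad _ (hemisphere_boundary_nonempty _ _ _)]
  constructor
  · intro h
    refine tendsto_atTop.2 fun M => ?_
    -- A width `ε` for which the strip is less than half of the limit law when `n * κ n = M`.
    obtain ⟨ε, hε0, hε⟩ : ∃ ε : ℝ≥0, 0 < ε ∧ halfGaussianCDF 1 (√M * ε) < 1 - 1 / 2 := by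
      have hc : Continuous fun ε : ℝ≥0 => halfGaussianCDF 1 (√M * ε) :=
        (continuous_halfGaussianCDF one_pos).comp (by fun_prop)
      have h0 := hc.tendsto 0
      rw [NNReal.coe_zero, mul_zero, halfGaussianCDF_zero] at h0
      have h1 := (h0.mono_left (nhdsWithin_le_nhds (s := Ioi 0))).eventually_lt_const
        (show (0 : ℝ) < 1 - 1 / 2 by norm_num)
      have h2 : ∀ᶠ ε : ℝ≥0 in 𝓝[>] 0, 0 < ε := self_mem_nhdsWithin
      exact (h2.and h1).exists
    filter_upwards [(h (1 / 2) (by norm_num)).eventually_lt_const (ENNReal.coe_pos.2 hε0),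
      (tendsto_pnat_latitudeCDF (by positivity)).eventually_lt_const hε] with n hn1 hn2
    by_contra! hlt
    -- Otherwise the strip of width `ε` has measure less than one half.
    refine hn1.not_ge ((hemisphere n (κ n) (hκ n)).le_partInRad ?_)
    rw [hemisphere_real_setOf_rho_le]
    refine (monotone_latitudeCDF n ?_).trans_lt hn2
    gcongr
  · intro h η hη
    refine ENNReal.tendsto_nhds_zero.2 fun δ hδ => ?_
    obtain ⟨ε, hε0, hε⟩ := ENNReal.lt_iff_exists_nnreal_btwn.1 hδ
    have hε0' : (0 : ℝ) < ε := NNReal.coe_pos.2 (ENNReal.coe_pos.1 hε0)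
    -- The strip of rescaled latitude at most `a` has limit measure more than `1 - η`.
    obtain ⟨a, ha, ha0⟩ := (((tendsto_halfGaussianCDF_atTop one_pos).eventually_const_lt
      (sub_lt_self 1 hη)).and (eventually_ge_atTop 0)).exists
    filter_upwards [(tendsto_pnat_latitudeCDF ha0).eventually_const_lt ha,
      (Real.tendsto_sqrt_atTop.comp h).eventually_ge_atTop (a / ε)] with n hn1 hn2
    refine ((hemisphere n (κ n) (hκ n)).partInRad_le ?_).trans hε.le
    rw [hemisphere_real_setOf_rho_le]
    exact hn1.le.trans (monotone_latitudeCDF n ((div_le_iff₀ hε0').1 hn2))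

theorem mainTheorem10 :
    (∀ (κ : ℝ) (hκ : 0 < κ) (η : ℝ), 0 < η → η ≤ 1 →
      Tendsto (fun n : ℕ+ =>
          (hemisphere n (κ / (n : ℝ)) (div_pos hκ (Nat.cast_pos.mpr n.pos))).obsInRad η)
        atTop (𝓝 ((halfGaussian κ 0 hκ).partInRad (1 - η))) ∧
      ∃ r : ℝ, 0 ≤ r ∧
        (halfGaussian κ 0 hκ).partInRad (1 - η) = ENNReal.ofReal r ∧
        (∫ t in (0 : ℝ)..r, Real.exp (-(κ / 2) * t ^ 2)) /
          (∫ t in Set.Ici (0 : ℝ), Real.exp (-(κ / 2) * t ^ 2)) = 1 - η) ∧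
    (∀ (κ : ℕ+ → ℝ) (hκ : ∀ n, 0 < κ n),
      IsBoundaryConcentrationFamily (fun n => hemisphere n (κ n) (hκ n)) ↔
        Tendsto (fun n : ℕ+ => (n : ℝ) * κ n) atTop atTop) := by
  refine ⟨fun κ hκ η hη0 hη1 => ?_, fun κ hκ => isBoundaryConcentrationFamily_hemisphere_iff hκ⟩
  obtain ⟨r, hr⟩ := exists_halfGaussianCDF_eq hκ (sub_nonneg.2 hη1) (sub_lt_self 1 hη0)
  have hG : (halfGaussian κ 0 hκ).partInRad (1 - η) = r := by
    rw [← hr]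
    exact MMSpaceWithBoundary.partInRad_eq ((strictMono_halfGaussianCDF hκ).strictMonoOn _)
      (halfGaussian_real_setOf_rho_le hκ) r
  refine ⟨?_, r, r.coe_nonneg, hG.trans ENNReal.ofReal_coe_nnreal.symm, hr⟩
  simp only [MMSpaceWithBoundary.obsInRad_eq_partInRad _ (hemisphere_boundary_nonempty _ _ _)]
  rw [hG, ← hr]
  exact tendsto_hemisphere_partInRad hκ r
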